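/- **Theorem 4.1.** Let $\eta\in\mathbb{R}^n$ have positive entries, let $\|x\|_{\infty,[\eta]^{-1}}=\max_i |x_i|/\eta_i$, and let $F:\mathbb{R}^n\to\mathbb{R}^n$ be Lipschitz with a nonempty set of zeros $\mathrm{zer}(F)=\{x: F(x)=0\}$. Suppose that, for some $c\ge 0$, $F$ is $c$-strongly monotone with respect to $\|\cdot\|_{\infty,[\eta]^{-1}}$ (with $c=0$ meaning monotone), i.e. for all $x,y\in\mathbb{R}^n$ and every index $i$ with $|x_i-y_i|/\eta_i=\|x-y\|_{\infty,[\eta]^{-1}}$, $$\frac{(F_i(x)-F_i(y))(x_i-y_i)}{\eta_i^2}\;\ge\; c\,\|x-y\|_{\infty,[\eta]^{-1}}^2 .$$ Let $DF(x)$ denote the Jacobian matrix of $F$, which exists for almost every $x$, let $|M|$ denote the entrywise absolute value of a matrix $M$, and let $\mathrm{diagL}(F)=\operatorname{ess\,sup}_{x\in\mathbb{R}^n}\max_i (DF(x))_{ii}$. Then the minimum $$b^\star=\min\bigl\{b\ge 0 \;:\; |(b+1)I-DF(x)|\,\eta\le (b+1)\,\eta \text{ entrywise, for almost every } x\in\mathbb{R}^n\bigr\}$$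 exists and satisfies $b^\star\le\max\{0,\mathrm{diagL}(F)-1\}$. Moreover, for every $\theta\in\bigl(0,\tfrac{1}{b^\star+1}\bigr)$ and every initial point $x(0)\in\mathbb{R}^n$, the forward step iteration $x(k+1)=x(k)-\theta F(x(k))$ converges to an element of $\mathrm{zer}(F)$. -/

import Mathlib

namespace ForwardStep

/-- The diagonally weighted sup norm `max_i |x_i| / η_i` on `ℝⁿ`; the outer norm is the sup norm
of `Fin n → ℝ`. -/
noncomputable def weightedNorm {n : ℕ} (η x : Fin n → ℝ) : ℝ :=
  ‖fun i => (η i)⁻¹ * x i‖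

/-- The indices at which the sup norm of `v` is attained. -/
def maxIndices {n : ℕ} (v : Fin n → ℝ) : Set (Fin n) :=
  {i | |v i| = ‖v‖}

/-- `F` is `c`-strongly monotone with respect to the weighted sup norm (`c = 0`: monotone):
the minimum of `(F_i(x) - F_i(y)) (x_i - y_i) / η_i²`, over the indices `i` where the weighted
norm of `x - y` is attained, is at least `c` times the square of that norm. -/
def StronglyMonotone {n : ℕ} (η : Fin n → ℝ) (c : ℝ) (F : (Fin n → ℝ) → (Fin n → ℝ)) : Prop :=
  ∀ x y : Fin n → ℝ, ∀ i ∈ maxIndices (fun j => (η j)⁻¹ * (x j - y j)),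
    c * weightedNorm η (x - y) ^ 2 ≤ (F x i - F y i) * (x i - y i) / η i ^ 2

/-- The Jacobian matrix; it is meaningful at the points where `F` is differentiable, that is,
at almost every point if `F` is Lipschitz. -/
noncomputable def jacobian {n : ℕ} (F : (Fin n → ℝ) → (Fin n → ℝ)) (x : Fin n → ℝ) :
    Matrix (Fin n) (Fin n) ℝ :=
  LinearMap.toMatrix' (fderiv ℝ F x : (Fin n → ℝ) →ₗ[ℝ] (Fin n → ℝ))

/-- The nonnegative majorant `|M|`: the matrix of the absolute values of the entries. -/
def absMatrix {n : ℕ} (M : Matrix (Fin n) (Fin n) ℝ) : Matrix (Fin n) (Fin n) ℝ :=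
  M.map fun a => |a|

/-- The essential supremum, for Lebesgue measure, of the largest diagonal Jacobian entry. -/
noncomputable def diagL {n : ℕ} (F : (Fin n → ℝ) → (Fin n → ℝ)) : ℝ :=
  essSup (fun x => ⨆ i, jacobian F x i i) MeasureTheory.volume

/-- The `b ≥ 0` with `|(b + 1) I - DF(x)| η ≤ (b + 1) η` entrywise for almost every `x`. -/
def admissible {n : ℕ} (η : Fin n → ℝ) (F : (Fin n → ℝ) → (Fin n → ℝ)) : Set ℝ :=
  {b | 0 ≤ b ∧ ∀ᵐ x : Fin n → ℝ,
    Matrix.mulVec (absMatrix ((b + 1) • (1 : Matrix (Fin n) (Fin n) ℝ) - jacobian F x)) η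
      ≤ (b + 1) • η}

/-- The set of zeros of `F`. -/
def zer {n : ℕ} (F : (Fin n → ℝ) → (Fin n → ℝ)) : Set (Fin n → ℝ) :=
  {x | F x = 0}

/-- The forward operator `Id - θ F`. -/
def forwardOp {n : ℕ} (θ : ℝ) (F : (Fin n → ℝ) → (Fin n → ℝ)) (x : Fin n → ℝ) : Fin n → ℝ :=
  x - θ • F x

end ForwardStep

/-!
At a point of differentiability, monotonicity of `F` in the weighted sup norm says that
`DF(x)` has nonnegative diagonal and that each row is diagonally dominant after scaling the columns
by `η` (`ForwardStep.sum_offDiag_le`). By Rademacher's theorem this holds almost everywhere, so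
`max 0 (diagL F - 1)` is admissible; the admissible set is closed and bounded below, hence it has
a least element, with the claimed bound.

For admissible `b`, the derivative of `Id - (b + 1)⁻¹ F` has weighted operator norm at most one
almost everywhere. A Lipschitz function whose derivative is bounded almost everywhere satisfies the
mean value inequality with the same bound (`LipschitzWith.abs_sub_le_of_ae_fderiv_le`), so this map
is nonexpansive in the weighted norm. For `0 < θ < 1 / (b + 1)` the map `Id - θ F` is a proper
average of it with the identity, and such averaged iterations converge to a fixed point as soon
as there is one (`krasnoselskii_mann`); the fixed points are the zeros of `F`. The sup norm is not
strictly convex, so the residuals are shown to vanish by the Goebel–Kirk inequality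
(`one_add_mul_norm_residual_le`).
-/

open MeasureTheory Filter Topology

/-! ### Increments of Lipschitz functions with an almost everywhere bounded derivative -/

/-- A bound on the derivative of a Lipschitz function in the direction `v`, even if it is only
known almost everywhere, bounds the increments along `v`. By Fubini, almost every segment
`[z, z + v]` meets the exceptional null set in a null set of parameters; along such a segment the
function is the integral of its derivative, and the remaining segments follow by continuity. -/
theorem LipschitzWith.abs_sub_le_of_ae_fderiv_le {E : Type*} [NormedAddCommGroup E]
    [NormedSpace ℝ E] [FiniteDimensional ℝ E] [MeasurableSpace E] [BorelSpace E]
    (μ : Measure E) [μ.IsAddHaarMeasure] {f : E → ℝ} {K : NNReal} (hf : LipschitzWith K f)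
    {v : E} {C : ℝ} (h : ∀ᵐ x ∂μ, |fderiv ℝ f x v| ≤ C) (x : E) :
    |f (x + v) - f x| ≤ C := by
  -- The good points contain a measurable set of full measure, to which Fubini applies.
  obtain ⟨T, hTsub, hTm, hT⟩ : ∃ T : Set E,
      T ⊆ {x | DifferentiableAt ℝ f x ∧ |fderiv ℝ f x v| ≤ C} ∧ MeasurableSet T ∧
        ∀ᵐ x ∂μ, x ∈ T := by
    have h0 : ∀ᵐ x ∂μ, x ∈ {x | DifferentiableAt ℝ f x ∧ |fderiv ℝ f x v| ≤ C} := by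
      filter_upwards [h, hf.ae_differentiableAt] with x h1 h2 using ⟨h2, h1⟩
    refine ⟨(toMeasurable μ {x | DifferentiableAt ℝ f x ∧ |fderiv ℝ f x v| ≤ C}ᶜ)ᶜ, ?_,
      (measurableSet_toMeasurable _ _).compl, ?_⟩
    · rw [Set.compl_subset_comm]
      exact subset_toMeasurable _ _
    · rw [ae_iff]
      simp only [Set.mem_compl_iff, not_not, Set.ofPred_mem_eq, measure_toMeasurable]
      exact h0
  have hline : ∀ᵐ z ∂μ, ∀ᵐ t : ℝ, z + t • v ∈ T := by
    have hm : MeasurableSet {p : ℝ × E | p.2 + p.1 • v ∈ T} := by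
      have : Measurable fun p : ℝ × E => p.2 + p.1 • v := by fun_prop
      exact this hTm
    refine (Measure.ae_ae_comm (μ := (volume : Measure ℝ)) (ν := μ)
      (p := fun t z => z + t • v ∈ T) hm).1 (Eventually.of_forall fun t => ?_)
    exact (measurePreserving_add_right μ (t • v)).quasiMeasurePreserving.ae hT
  have key : ∀ᵐ z ∂μ, |f (z + v) - f z| ≤ C := by
    filter_upwards [hline] with z hz
    have hlip : LipschitzWith (K * ‖v‖₊) fun t : ℝ => f (z + t • v) := by
      refine hf.comp (LipschitzWith.of_dist_le_mul fun s t => ?_)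
      rw [dist_add_left, dist_eq_norm, ← sub_smul, norm_smul, mul_comm, dist_eq_norm]
      rfl
    have hac := (hlip.lipschitzOnWith (s := Set.uIcc (0 : ℝ) 1)).absolutelyContinuousOnInterval
    have hint := hac.integral_deriv_eq_sub
    simp only [one_smul, zero_smul, add_zero] at hint
    rw [← hint, ← Real.norm_eq_abs]
    have hb : ∀ᵐ t : ℝ, t ∈ Set.uIoc (0 : ℝ) 1 → ‖deriv (fun t : ℝ => f (z + t • v)) t‖ ≤ C := by
      filter_upwards [hz] with t ht _
      obtain ⟨hd, hle⟩ := hTsub ht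
      have hc : HasDerivAt (fun t : ℝ => z + t • v) v t := by
        simpa using ((hasDerivAt_id t).smul_const v).const_add z
      have := hd.hasFDerivAt.comp_hasDerivAt t hc
      rw [show deriv (fun t : ℝ => f (z + t • v)) t = _ from this.deriv]
      exact hle
    simpa using intervalIntegral.norm_integral_le_of_norm_le_const_ae hb
  have hclosed : IsClosed {z | |f (z + v) - f z| ≤ C} := by
    have := hf.continuous
    exact isClosed_le (by fun_prop) continuous_const
  have hdense : Dense {z | |f (z + v) - f z| ≤ C} := Measure.dense_of_ae key
  have := hclosed.closure_eq ▸ hdense x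
  exact this

/-! ### Krasnoselskii–Mann iteration in a normed space -/

section KrasnoselskiiMann

variable {E : Type*} [NormedAddCommGroup E] [NormedSpace ℝ E] {T : E → E} {a : ℝ} {x : ℕ → E}

theorem norm_residual_antitone (hT : LipschitzWith 1 T) (h0 : 0 < a) (h1 : a < 1)
    (hx : ∀ k, x (k + 1) = (1 - a) • x k + a • T (x k)) :
    Antitone fun k => ‖T (x k) - x k‖ := by
  refine antitone_nat_of_succ_le fun k => ?_
  have e : T (x (k + 1)) - x (k + 1) =
      (T (x (k + 1)) - T (x k)) + (1 - a) • (T (x k) - x k) := by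
    nth_rewrite 2 [hx k]; module
  have e2 : x (k + 1) - x k = a • (T (x k) - x k) := by rw [hx k]; module
  have h2 := hT.norm_sub_le (x (k + 1)) (x k)
  rw [e2, norm_smul, Real.norm_of_nonneg h0.le] at h2
  have h3 := norm_add_le (T (x (k + 1)) - T (x k)) ((1 - a) • (T (x k) - x k))
  rw [norm_smul, Real.norm_of_nonneg (by linarith)] at h3
  rw [e]
  simp only [NNReal.coe_one, one_mul] at h2
  linarith

/-- The Goebel–Kirk inequality, which makes averaged iterations asymptotically regular in norms
that need not be strictly convex. -/
theorem one_add_mul_norm_residual_le (hT : LipschitzWith 1 T) (h0 : 0 < a) (h1 : a < 1)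
    (hx : ∀ k, x (k + 1) = (1 - a) • x k + a • T (x k)) (m i : ℕ) :
    (1 + m * a) * ‖T (x i) - x i‖ ≤ ‖T (x (i + m)) - x i‖ +
      ((1 - a)⁻¹) ^ m * (‖T (x i) - x i‖ - ‖T (x (i + m)) - x (i + m)‖) := by
  have hanti := norm_residual_antitone hT h0 h1 hx
  induction m generalizing i with
  | zero => simp
  | succ m ih =>
    have ih := ih (i + 1)
    rw [show i + 1 + m = i + (m + 1) by ring] at ih
    have hd : ‖T (x (i + 1)) - x (i + 1)‖ ≤ ‖T (x i) - x i‖ := hanti (Nat.le_succ i)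
    have hdist : ∀ j, ‖x (i + j) - x i‖ ≤ j * (a * ‖T (x i) - x i‖) := by
      intro j
      induction j with
      | zero => simp
      | succ j ihj =>
        have e : x (i + (j + 1)) - x i = (x (i + j) - x i) + a • (T (x (i + j)) - x (i + j)) := by
          rw [← add_assoc, hx (i + j)]; module
        have h2 : ‖T (x (i + j)) - x (i + j)‖ ≤ ‖T (x i) - x i‖ := hanti (Nat.le_add_right i j)
        have h3 := norm_add_le (x (i + j) - x i) (a • (T (x (i + j)) - x (i + j)))
        rw [norm_smul, Real.norm_of_nonneg h0.le] at h3
        rw [e]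
        push_cast
        nlinarith
    have htri : ‖T (x (i + (m + 1))) - x (i + 1)‖ ≤
        (1 - a) * ‖T (x (i + (m + 1))) - x i‖ + a * ((m + 1 : ℕ) * (a * ‖T (x i) - x i‖)) := by
      have e : T (x (i + (m + 1))) - x (i + 1) =
          (1 - a) • (T (x (i + (m + 1))) - x i) + a • (T (x (i + (m + 1))) - T (x i)) := by
        rw [hx i]; module
      have h3 := norm_add_le ((1 - a) • (T (x (i + (m + 1))) - x i))
        (a • (T (x (i + (m + 1))) - T (x i)))
      rw [norm_smul, norm_smul, Real.norm_of_nonneg h0.le,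
        Real.norm_of_nonneg (by linarith : (0 : ℝ) ≤ 1 - a)] at h3
      have h4 := hT.norm_sub_le (x (i + (m + 1))) (x i)
      simp only [NNReal.coe_one, one_mul] at h4
      rw [e]
      exact h3.trans (by gcongr; exact h4.trans (hdist _))
    have hpos : 0 < 1 - a := by linarith
    have hbern : 1 + m * a ≤ ((1 - a)⁻¹) ^ m := by
      have h2 : 1 + a ≤ (1 - a)⁻¹ := by
        rw [le_inv_comm₀ (by linarith) hpos, ← one_div, le_div_iff₀ (by linarith)]
        nlinarith
      exact (one_add_mul_le_pow (by linarith) m).trans (pow_le_pow_left₀ (by linarith) h2 m)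
    set d := ‖T (x i) - x i‖
    set d' := ‖T (x (i + 1)) - x (i + 1)‖
    set q := ((1 - a)⁻¹) ^ m with hq
    -- The coefficient `1 + m * a - q` of `d'` is nonpositive by `hbern`, so `d'` may be replaced
    -- by the larger `d`.
    have hfin : (1 - a) * ((1 + (m + 1) * a) * d) ≤ (1 - a) * ‖T (x (i + (m + 1))) - x i‖ +
        q * (d - ‖T (x (i + (m + 1))) - x (i + (m + 1))‖) := by
      push_cast at htri
      nlinarith [mul_nonneg (sub_nonneg.2 hbern) (sub_nonneg.2 hd)]
    have h5 : ((1 - a)⁻¹) ^ (m + 1) = (1 - a)⁻¹ * q := by rw [pow_succ, mul_comm]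
    rw [h5]
    push_cast
    have := mul_le_mul_of_nonneg_left hfin (inv_nonneg.2 hpos.le)
    rw [mul_add, inv_mul_cancel_left₀ hpos.ne', inv_mul_cancel_left₀ hpos.ne'] at this
    linarith

/-- Averaged iterations of a nonexpansive map with a bounded orbit are asymptotically regular: if
the residuals decreased to `r > 0`, the left side of `one_add_mul_norm_residual_le` would tend to
`(1 + m * a) * r` as `i → ∞`, while its right side stays bounded uniformly in `m`. -/
theorem tendsto_residual (hT : LipschitzWith 1 T) (h0 : 0 < a) (h1 : a < 1)
    (hx : ∀ k, x (k + 1) = (1 - a) • x k + a • T (x k)) {B : ℝ}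
    (hB : ∀ i j, ‖T (x j) - x i‖ ≤ B) :
    Tendsto (fun k => ‖T (x k) - x k‖) atTop (𝓝 0) := by
  have hanti := norm_residual_antitone hT h0 h1 hx
  have hlim := tendsto_atTop_ciInf hanti
    ⟨0, by rintro _ ⟨k, rfl⟩; exact norm_nonneg _⟩
  set r := ⨅ k, ‖T (x k) - x k‖
  have hr : 0 ≤ r := ge_of_tendsto' hlim fun k => norm_nonneg _
  have hm : ∀ m : ℕ, (1 + m * a) * r ≤ B := by
    intro m
    have hshift : Tendsto (fun k => ‖T (x (k + m)) - x (k + m)‖) atTop (𝓝 r) :=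
      (tendsto_add_atTop_iff_nat m).2 hlim
    have hl := hlim.const_mul (1 + m * a)
    have hR := ((hlim.sub hshift).const_mul (((1 - a)⁻¹) ^ m)).const_add B
    simp only [sub_self, mul_zero, add_zero] at hR
    exact le_of_tendsto_of_tendsto' hl hR fun i =>
      (one_add_mul_norm_residual_le hT h0 h1 hx m i).trans (by gcongr; exact hB _ _)
  have : r = 0 := by
    by_contra hne
    have hrpos : 0 < r := lt_of_le_of_ne hr (Ne.symm hne)
    obtain ⟨m, hmB⟩ := exists_nat_gt (B / (a * r))
    rw [div_lt_iff₀ (by positivity)] at hmB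
    nlinarith [hm m]
  rwa [this] at hlim

/-- Krasnoselskii–Mann: averaged iterations of a nonexpansive map with a fixed point converge to a
fixed point. Asymptotic regularity makes every cluster point of the orbit a fixed point, and the
distances of the orbit to a fixed point are nonincreasing. -/
theorem krasnoselskii_mann [ProperSpace E] (hT : LipschitzWith 1 T) (h0 : 0 < a) (h1 : a < 1)
    (hx : ∀ k, x (k + 1) = (1 - a) • x k + a • T (x k)) {p : E} (hp : T p = p) :
    ∃ z, T z = z ∧ Tendsto x atTop (𝓝 z) := by
  have hT' : ∀ q, T q = q → ∀ y, ‖T y - q‖ ≤ ‖y - q‖ := by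
    intro q hq y
    simpa [hq] using hT.norm_sub_le y q
  have hfejer : ∀ q, T q = q → Antitone fun k => ‖x k - q‖ := by
    intro q hq
    refine antitone_nat_of_succ_le fun k => ?_
    have e : x (k + 1) - q = (1 - a) • (x k - q) + a • (T (x k) - q) := by rw [hx k]; module
    have h3 := norm_add_le ((1 - a) • (x k - q)) (a • (T (x k) - q))
    rw [norm_smul, norm_smul, Real.norm_of_nonneg h0.le,
      Real.norm_of_nonneg (by linarith : (0 : ℝ) ≤ 1 - a)] at h3
    rw [e]
    nlinarith [hT' q hq (x k)]
  have hbd : ∀ k, ‖x k - p‖ ≤ ‖x 0 - p‖ := fun k => hfejer p hp (Nat.zero_le k)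
  have hres : Tendsto (fun k => ‖T (x k) - x k‖) atTop (𝓝 0) := by
    refine tendsto_residual hT h0 h1 hx (B := ‖x 0 - p‖ + ‖x 0 - p‖) fun i j => ?_
    have e : T (x j) - x i = (T (x j) - p) - (x i - p) := by abel
    rw [e]
    exact (norm_sub_le _ _).trans (add_le_add ((hT' p hp _).trans (hbd j)) (hbd i))
  obtain ⟨z, -, φ, hφ, hz⟩ := (isCompact_closedBall p ‖x 0 - p‖).tendsto_subseq
    (fun k => mem_closedBall_iff_norm.2 (hbd k))
  have hTz : T z = z := by
    have l1 : Tendsto (fun k => ‖T (x (φ k)) - x (φ k)‖) atTop (𝓝 ‖T z - z‖) :=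
      (((hT.continuous.tendsto z).comp hz).sub hz).norm
    have := tendsto_nhds_unique l1 (hres.comp hφ.tendsto_atTop)
    exact sub_eq_zero.1 (norm_eq_zero.1 this)
  refine ⟨z, hTz, ?_⟩
  rw [tendsto_iff_norm_sub_tendsto_zero]
  have hlim := tendsto_atTop_ciInf (hfejer z hTz)
    ⟨0, by rintro _ ⟨k, rfl⟩; exact norm_nonneg _⟩
  have l2 := tendsto_nhds_unique (hlim.comp hφ.tendsto_atTop)
    (tendsto_iff_norm_sub_tendsto_zero.1 hz)
  rwa [l2] at hlim

end KrasnoselskiiMann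

namespace ForwardStep

/-! ### Diagonal dominance of the Jacobian and the admissible set -/

variable {n : ℕ} {η : Fin n → ℝ} {F : (Fin n → ℝ) → (Fin n → ℝ)}

theorem jacobian_mulVec (F : (Fin n → ℝ) → (Fin n → ℝ)) (x v : Fin n → ℝ) :
    (jacobian F x).mulVec v = fderiv ℝ F x v := by
  simp [jacobian, LinearMap.toMatrix'_mulVec]

theorem abs_jacobian_diag_le {K : NNReal} (hF : LipschitzWith K F) (x : Fin n → ℝ) (i : Fin n) :
    |jacobian F x i i| ≤ K := by
  have e : jacobian F x i i = fderiv ℝ F x (Pi.single i 1) i := by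
    rw [← jacobian_mulVec]; simp
  rw [e, ← Real.norm_eq_abs]
  refine (norm_le_pi_norm _ i).trans ((ContinuousLinearMap.le_opNorm _ _).trans ?_)
  have h1 : ‖(Pi.single i 1 : Fin n → ℝ)‖ ≤ 1 := by
    refine (pi_norm_le_iff_of_nonneg zero_le_one).2 fun j => ?_
    by_cases h : j = i
    · subst h; simp
    · simp [h]
  calc _ ≤ (K : ℝ) * 1 :=
        mul_le_mul (norm_fderiv_le_of_lipschitz ℝ hF) h1 (norm_nonneg _) K.2
    _ = K := mul_one _

/-- Monotonicity in the weighted sup norm makes the Jacobian, with columns scaled by `η`,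
diagonally dominant: test monotonicity along the direction `v` with `v i = η i` and
`v j = -sign (DF(x) i j) * η j`, in which the index `i` attains the norm. -/
theorem sum_offDiag_le (hη : ∀ i, 0 < η i) {c : ℝ} (hc : 0 ≤ c) (hmono : StronglyMonotone η c F)
    {x : Fin n → ℝ} (hx : DifferentiableAt ℝ F x) (i : Fin n) :
    ∑ j ∈ Finset.univ.erase i, |jacobian F x i j| * η j ≤ jacobian F x i i * η i := by
  set M := jacobian F x with hM
  set v : Fin n → ℝ := fun j => if j = i then η i else - SignType.sign (M i j) * η j with hv
  have hvi : v i = η i := by simp [hv]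
  have hvle : ∀ j, |(η j)⁻¹ * v j| ≤ 1 := by
    intro j
    by_cases h : j = i
    · subst h; rw [hvi, inv_mul_cancel₀ (hη j).ne']; simp
    · have hs : |((SignType.sign (M i j) : SignType) : ℝ)| ≤ 1 := by
        rcases lt_trichotomy (M i j) 0 with h | h | h <;> simp [h]
      have : (η j)⁻¹ * v j = - SignType.sign (M i j) := by
        simp only [hv, h, if_false]
        field_simp [(hη j).ne']
      rw [this, abs_neg]; exact hs
  have hder : HasDerivAt (fun t : ℝ => F (x + t • v) i) (M.mulVec v i) 0 := by
    have hc : HasDerivAt (fun t : ℝ => x + t • v) v 0 := by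
      simpa using ((hasDerivAt_id (0 : ℝ)).smul_const v).const_add x
    have h2 : HasFDerivAt F (fderiv ℝ F x) (x + (0 : ℝ) • v) := by simpa using hx.hasFDerivAt
    have := hasDerivAt_pi.1 (h2.comp_hasDerivAt 0 hc) i
    rw [hM, jacobian_mulVec]; exact this
  have hnonneg : 0 ≤ M.mulVec v i := by
    have hs := hder.tendsto_slope_zero_right
    refine ge_of_tendsto hs ?_
    filter_upwards [self_mem_nhdsWithin] with t (ht : 0 < t)
    have hmem : i ∈ maxIndices (fun j => (η j)⁻¹ * ((x + t • v) j - x j)) := by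
      have e : ∀ j, (η j)⁻¹ * ((x + t • v) j - x j) = t * ((η j)⁻¹ * v j) := by
        intro j; simp; ring
      simp only [e, maxIndices, Set.mem_ofPred_eq]
      have ei : |t * ((η i)⁻¹ * v i)| = t := by
        rw [hvi, inv_mul_cancel₀ (hη i).ne', mul_one, abs_of_pos ht]
      apply le_antisymm
      · exact norm_le_pi_norm (fun j => t * ((η j)⁻¹ * v j)) i
      · rw [ei]
        refine (pi_norm_le_iff_of_nonneg ht.le).2 fun j => ?_
        rw [Real.norm_eq_abs, abs_mul, abs_of_pos ht]
        exact mul_le_of_le_one_right ht.le (hvle j)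
    have h := (mul_nonneg hc (sq_nonneg _)).trans (hmono (x + t • v) x i hmem)
    have e : (x + t • v) i - x i = t * η i := by simp [hvi]
    rw [e] at h
    have hηi := hη i
    have h2 : 0 ≤ F (x + t • v) i - F x i := by
      by_contra hneg
      push Not at hneg
      exact absurd h (not_le.2 (div_neg_of_neg_of_pos
        (mul_neg_of_neg_of_pos hneg (by positivity)) (by positivity)))
    simp only [zero_add, zero_smul, add_zero, smul_eq_mul]
    positivity
  have hsum : M.mulVec v i =
      M i i * η i - ∑ j ∈ Finset.univ.erase i, |M i j| * η j := by
    rw [Matrix.mulVec, dotProduct, ← Finset.add_sum_erase _ _ (Finset.mem_univ i), hvi,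
      sub_eq_add_neg, ← Finset.sum_neg_distrib]
    congr 1
    refine Finset.sum_congr rfl fun j hj => ?_
    simp only [hv, Finset.ne_of_mem_erase hj, if_false]
    rw [← self_mul_sign (M i j)]
    ring
  linarith

/-- If `b + 1` is at least every diagonal entry, the absolute value on the diagonal of
`(b + 1) I - DF(x)` can be dropped, and diagonal dominance gives the required row inequality. -/
theorem max_zero_diagL_sub_one_mem_admissible (hη : ∀ i, 0 < η i) {K : NNReal}
    (hF : LipschitzWith K F) {c : ℝ} (hc : 0 ≤ c) (hmono : StronglyMonotone η c F) :
    max 0 (diagL F - 1) ∈ admissible η F := by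
  refine ⟨le_max_left _ _, ?_⟩
  -- The real-valued `essSup` is a genuine bound only because the diagonal entries are bounded.
  have hbdd : ∀ x, (⨆ i, jacobian F x i i) ≤ K := fun x =>
    Real.iSup_le (fun i => (le_abs_self _).trans (abs_jacobian_diag_le hF x i)) K.2
  have hess : ∀ᵐ x : Fin n → ℝ, (⨆ i, jacobian F x i i) ≤ diagL F :=
    ae_le_essSup (isBoundedUnder_of ⟨K, hbdd⟩)
  filter_upwards [hess, hF.ae_differentiableAt] with x h1 h2 i
  set b := max 0 (diagL F - 1)
  have hdiag : jacobian F x i i ≤ b + 1 := by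
    have := (le_ciSup (Set.finite_range _).bddAbove i).trans h1
    have := le_max_right 0 (diagL F - 1)
    linarith
  have hoff := sum_offDiag_le hη hc hmono h2 i
  rw [Matrix.mulVec, dotProduct, ← Finset.add_sum_erase _ _ (Finset.mem_univ i)]
  have e : ∑ j ∈ Finset.univ.erase i,
      absMatrix ((b + 1) • (1 : Matrix (Fin n) (Fin n) ℝ) - jacobian F x) i j * η j =
      ∑ j ∈ Finset.univ.erase i, |jacobian F x i j| * η j := by
    refine Finset.sum_congr rfl fun j hj => ?_
    simp [absMatrix, Matrix.one_apply_ne (Finset.ne_of_mem_erase hj).symm]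
  have e2 : absMatrix ((b + 1) • (1 : Matrix (Fin n) (Fin n) ℝ) - jacobian F x) i i =
      b + 1 - jacobian F x i i := by
    simp only [absMatrix, Matrix.map_apply, Matrix.sub_apply, Matrix.smul_apply,
      Matrix.one_apply_eq, smul_eq_mul, mul_one]
    exact abs_of_nonneg (by linarith)
  rw [e, e2, Pi.smul_apply, smul_eq_mul]
  linarith

theorem isClosed_admissible (η : Fin n → ℝ) (F : (Fin n → ℝ) → (Fin n → ℝ)) :
    IsClosed (admissible η F) := by
  refine isClosed_of_closure_subset fun b hb => ?_
  obtain ⟨u, hu, hlim⟩ := mem_closure_iff_seq_limit.1 hb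
  refine ⟨ge_of_tendsto' hlim fun k => (hu k).1, ?_⟩
  filter_upwards [ae_all_iff.2 fun k => (hu k).2] with x hx
  have hcl : IsClosed {t : ℝ | Matrix.mulVec
      (absMatrix ((t + 1) • (1 : Matrix (Fin n) (Fin n) ℝ) - jacobian F x)) η
        ≤ (t + 1) • η} := by
    refine isClosed_le ?_ (by fun_prop)
    refine Continuous.matrix_mulVec ?_ continuous_const
    refine Continuous.matrix_map ?_ continuous_abs
    fun_prop
  exact hcl.mem_of_tendsto hlim (Eventually.of_forall hx)

/-! ### Nonexpansiveness and convergence of the forward step -/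

/-- For admissible `b`, the map `(b + 1) Id - F` is Lipschitz with constant `b + 1` in the
weighted sup norm; `r` bounds the weighted norm of the increment `v`. -/
theorem abs_sub_le_of_mem_admissible {K : NNReal} (hF : LipschitzWith K F) {b : ℝ}
    (hb : b ∈ admissible η F) {v : Fin n → ℝ} {r : ℝ}
    (hr : 0 ≤ r) (hv : ∀ j, |v j| ≤ η j * r) (x : Fin n → ℝ) (i : Fin n) :
    |((b + 1) * (x + v) i - F (x + v) i) - ((b + 1) * x i - F x i)| ≤ (b + 1) * η i * r := by
  have hlip : ∃ L : NNReal, LipschitzWith L fun y : Fin n → ℝ => (b + 1) * y i - F y i := by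
    refine ⟨_, LipschitzWith.sub (Kf := ‖b + 1‖₊ * 1) (Kg := 1 * K) ?_ ?_⟩
    · exact (lipschitzWith_smul (b + 1)).comp (LipschitzWith.eval i)
    · exact (LipschitzWith.eval (α := fun _ : Fin n => ℝ) i).comp hF
  obtain ⟨L, hL⟩ := hlip
  refine hL.abs_sub_le_of_ae_fderiv_le volume ?_ x
  filter_upwards [hb.2, hF.ae_differentiableAt] with y hy hd
  have hder : fderiv ℝ (fun y : Fin n → ℝ => (b + 1) * y i - F y i) y v =
      ((b + 1) • (1 : Matrix (Fin n) (Fin n) ℝ) - jacobian F y).mulVec v i := by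
    have hp : HasFDerivAt (fun y : Fin n → ℝ => y i)
        (ContinuousLinearMap.proj (R := ℝ) (φ := fun _ : Fin n => ℝ) i) y :=
      (ContinuousLinearMap.proj (R := ℝ) (φ := fun _ : Fin n => ℝ) i).hasFDerivAt
    rw [((hp.const_mul (b + 1)).fun_sub (hasFDerivAt_pi'.1 hd.hasFDerivAt i)).fderiv]
    simp [Matrix.sub_mulVec, Matrix.smul_mulVec, jacobian_mulVec]
  rw [hder]
  have hyi := hy i
  rw [Pi.smul_apply, smul_eq_mul] at hyi
  calc _ ≤ ∑ j, |((b + 1) • (1 : Matrix (Fin n) (Fin n) ℝ) - jacobian F y) i j| * (η j * r) := by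
        rw [Matrix.mulVec, dotProduct]
        refine (Finset.abs_sum_le_sum_abs _ _).trans (Finset.sum_le_sum fun j _ => ?_)
        rw [abs_mul]
        exact mul_le_mul_of_nonneg_left (hv j) (abs_nonneg _)
    _ = (absMatrix ((b + 1) • (1 : Matrix (Fin n) (Fin n) ℝ) - jacobian F y)).mulVec η i * r := by
        rw [Matrix.mulVec, dotProduct, Finset.sum_mul]
        exact Finset.sum_congr rfl fun j _ => by rw [absMatrix, Matrix.map_apply]; ring
    _ ≤ _ := mul_le_mul_of_nonneg_right hyi hr

/-- In the coordinates `u = η⁻¹ * x` the weighted norm is the sup norm, and the forward step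
with size `θ` is the average, with weight `θ * (b + 1)`, of `u` and the nonexpansive forward step
with size `1 / (b + 1)`. -/
theorem exists_tendsto_of_mem_admissible (hη : ∀ i, 0 < η i) {K : NNReal}
    (hF : LipschitzWith K F) (hzer : (zer F).Nonempty) {b : ℝ} (hb : b ∈ admissible η F)
    {θ : ℝ} (hθ : θ ∈ Set.Ioo 0 (1 / (b + 1))) {x : ℕ → Fin n → ℝ}
    (hx : ∀ k, x (k + 1) = forwardOp θ F (x k)) :
    ∃ z ∈ zer F, Tendsto x atTop (𝓝 z) := by
  have hb1 : 0 < b + 1 := by linarith [hb.1]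
  have hcancel : ∀ y : Fin n → ℝ, η * (η⁻¹ * y) = y := fun y => by
    ext i; simp [mul_inv_cancel_left₀ (hη i).ne']
  set T : (Fin n → ℝ) → Fin n → ℝ := fun u => u - (b + 1)⁻¹ • (η⁻¹ * F (η * u)) with hT
  have hTlip : LipschitzWith 1 T := by
    refine LipschitzWith.of_dist_le_mul fun u w => ?_
    rw [NNReal.coe_one, one_mul, dist_eq_norm, dist_eq_norm]
    refine (pi_norm_le_iff_of_nonneg (norm_nonneg _)).2 fun i => ?_
    have h := abs_sub_le_of_mem_admissible hF hb (v := η * (u - w)) (norm_nonneg (u - w))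
      (fun j => by
        rw [Pi.mul_apply, abs_mul, abs_of_pos (hη j)]
        exact mul_le_mul_of_nonneg_left (norm_le_pi_norm (u - w) j) (hη j).le) (η * w) i
    rw [show η * w + η * (u - w) = η * u by ring] at h
    have hηi := hη i
    have e : (T u - T w) i = (((b + 1) * (η * u) i - F (η * u) i) -
        ((b + 1) * (η * w) i - F (η * w) i)) / ((b + 1) * η i) := by
      simp only [hT, Pi.sub_apply, Pi.smul_apply, Pi.mul_apply, Pi.inv_apply, smul_eq_mul]
      field_simp
    rw [e, Real.norm_eq_abs, abs_div, abs_of_pos (by positivity : 0 < (b + 1) * η i),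
      div_le_iff₀ (by positivity), mul_comm ‖u - w‖]
    exact h
  have hfix : ∀ u, T u = u → η * u ∈ zer F := by
    intro u hu
    have h : (b + 1)⁻¹ • (η⁻¹ * F (η * u)) = 0 := sub_eq_self.1 hu
    have h2 := (smul_eq_zero.1 h).resolve_left (inv_pos.2 hb1).ne'
    show F (η * u) = 0
    rw [← hcancel (F (η * u)), h2, mul_zero]
  obtain ⟨p, hp⟩ := hzer
  have hpT : T (η⁻¹ * p) = η⁻¹ * p := by
    simp only [hT, hcancel]
    rw [show F p = 0 from hp]; simp
  have hstep : ∀ k, η⁻¹ * x (k + 1) = (1 - θ * (b + 1)) • (η⁻¹ * x k) +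
      (θ * (b + 1)) • T (η⁻¹ * x k) := by
    intro k
    rw [hx k]
    simp only [hT, hcancel, forwardOp]
    ext i
    simp only [Pi.sub_apply, Pi.smul_apply, Pi.mul_apply, Pi.add_apply, Pi.inv_apply, smul_eq_mul]
    field_simp
    ring
  have hlt : θ * (b + 1) < 1 := (lt_div_iff₀ hb1).1 hθ.2
  obtain ⟨z, hz, hlim⟩ := krasnoselskii_mann (x := fun k => η⁻¹ * x k) hTlip
    (mul_pos hθ.1 hb1) hlt hstep hpT
  refine ⟨η * z, hfix z hz, ?_⟩
  simpa only [hcancel] using hlim.const_mul η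

end ForwardStep

theorem theorem4p1 {n : ℕ} (η : Fin n → ℝ) (hη : ∀ i, 0 < η i)
    (F : (Fin n → ℝ) → (Fin n → ℝ)) (hLip : ∃ K : NNReal, LipschitzWith K F)
    (hzer : (ForwardStep.zer F).Nonempty)
    (c : ℝ) (hc : 0 ≤ c) (hmono : ForwardStep.StronglyMonotone η c F) :
    ∃ bStar : ℝ, IsLeast (ForwardStep.admissible η F) bStar ∧
      bStar ≤ max 0 (ForwardStep.diagL F - 1) ∧
      ∀ θ : ℝ, θ ∈ Set.Ioo 0 (1 / (bStar + 1)) →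
        ∀ x : ℕ → Fin n → ℝ, (∀ k, x (k + 1) = ForwardStep.forwardOp θ F (x k)) →
          ∃ z ∈ ForwardStep.zer F, Filter.Tendsto x Filter.atTop (nhds z) := by
  obtain ⟨K, hK⟩ := hLip
  have hmem := ForwardStep.max_zero_diagL_sub_one_mem_admissible hη hK hc hmono
  have hleast := (ForwardStep.isClosed_admissible η F).isLeast_csInf ⟨_, hmem⟩
    ⟨0, fun b hb => hb.1⟩
  exact ⟨_, hleast, hleast.2 hmem, fun θ hθ x hx =>
    ForwardStep.exists_tendsto_of_mem_admissible hη hK hzer hleast.1 hθ hx⟩
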